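/- Let $T\in\{-1,0,1\}^{k\times n}$ be a totally unimodular matrix (every square submatrix has determinant in $\{-1,0,1\}$), let $b\in\mathbb{Z}^k$, and let $I\subseteq[n]$ be a subset of the column indices. Let $Q\subseteq\mathbb{R}^I$ be the axis-parallel projection of $P:=\{x\in\mathbb{R}^n : Tx\le b\}$ on the variables $(x_i)_{i\in I}$, that is, $Q=\{(x_i)_{i\in I} : x\in P\}$. Call $v\in\mathbb{Z}^I$ an edge direction of $Q$ if the greatest common divisor of its components is $1$ and there are integral points $x_1,x_2\in\mathbb{Z}^I$ on a common edge ($1$-dimensional face, where $Q$ counts as a face of itself) of $Q$ with $x_1=x_2+v$. Call $w\in\mathbb{Z}^n$ TU-appendable to $T$ if the matrix $\begin{pmatrix}T\\ w^\top\end{pmatrix}$ is totally unimodular. Then for every edge direction $v\in\mathbb{Z}^I$ of $Q$ and every $w\in\mathbb{Z}^n$ that is TU-appendable to $T$ and supported on $I$ (i.e. $w_i=0$ for $i\notin I$), we have $$w_I^\top v=\sum_{i\in I} w_i v_i\in\{-1,0,1\}.$$ -/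

import Mathlib

open Matrix

namespace TUProjection

/-- The polyhedron `{x ∈ ℝⁿ : T x ≤ b}` of an integral system of linear inequalities. -/
def polyhedron {k n : ℕ} (T : Matrix (Fin k) (Fin n) ℤ) (b : Fin k → ℤ) : Set (Fin n → ℝ) :=
  {x | ∀ i, (T.map (Int.cast : ℤ → ℝ) *ᵥ x) i ≤ (b i : ℝ)}

/-- The axis-parallel projection of `P ⊆ ℝⁿ` on the variables `(x_i)_{i ∈ I}`. -/
def axisProjection {n : ℕ} (I : Finset (Fin n)) (P : Set (Fin n → ℝ)) : Set (I → ℝ) :=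
  (fun x (i : I) => x i) '' P

/-- `d` is TU-appendable to `T` if `T` with the additional row `dᵀ` is totally unimodular. -/
def TUAppendable {k n : ℕ} (T : Matrix (Fin k) (Fin n) ℤ) (d : Fin n → ℤ) : Prop :=
  (Matrix.fromRows T (Matrix.replicateRow Unit d)).IsTotallyUnimodular

/-- An edge of a polyhedron `Q` is a face of dimension one. A (nonempty) face is the set of
maximizers over `Q` of some linear functional; the zero functional gives `Q` itself. -/
def IsEdge {ι : Type*} [Fintype ι] (Q F : Set (ι → ℝ)) : Prop :=
  IsExposed ℝ Q F ∧ Module.finrank ℝ (vectorSpan ℝ F) = 1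

/-- An edge direction of `Q`: an integral vector with coprime components that is the difference
of two integral points on a common edge of `Q`. -/
def IsEdgeDirection {ι : Type*} [Fintype ι] (Q : Set (ι → ℝ)) (v : ι → ℤ) : Prop :=
  Finset.univ.gcd v = 1 ∧
    ∃ F : Set (ι → ℝ), IsEdge Q F ∧
      ∃ x₁ x₂ : ι → ℤ, (fun i => (x₁ i : ℝ)) ∈ F ∧ (fun i => (x₂ i : ℝ)) ∈ F ∧ x₁ = x₂ + v

end TUProjection

/-! Let `c = w ⬝ᵥ v ≠ 0`, and let `x`, `x + v` lie on the edge. The point `x + v / |c|` of the edge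
has integral `w`-value, one unit away from that of `x`; lift it to a point `p` of the polyhedron.
Since `T` with row `w` appended is totally unimodular, `p` rounds to an integral `z` whose row
values are floors or ceilings of those of `p` (`exists_floor_le_mulVec_le_ceil`). Integral values
persist: the `w`-value is kept and tight constraints stay tight, so `z` projects into the same edge
(`restrict_mem_of_isExtreme`). Hence the projection of `z` is `x + v / |c|`, so `|c|` divides every
entry of `v`, and coprimality forces `|c| = 1`. -/

namespace Matrix

/-! ### Rounding with totally unimodular matrices -/

/-- A matrix with trivial kernel has a nonsingular square submatrix using all columns. -/
lemma exists_det_submatrix_ne_zero {m n K : Type*} [Finite m] [Fintype n] [DecidableEq n]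
    [Field K] (A : Matrix m n K) (hA : ∀ d, A *ᵥ d = 0 → d = 0) :
    ∃ f : n → m, (A.submatrix f id).det ≠ 0 := by
  have hinj : Function.Injective A.mulVecLin :=
    LinearMap.ker_eq_bot.1 (LinearMap.ker_eq_bot'.2 hA)
  have hrank : Module.finrank K (Submodule.span K (Set.range A.row)) = Fintype.card n := by
    rw [← rank_eq_finrank_span_row, rank, LinearMap.finrank_range_of_inj hinj,
      Module.finrank_fintype_fun_eq_card]
  obtain ⟨g, hg, -, hli⟩ :=
    Submodule.exists_fun_fin_finrank_span_eq K (Set.range A.row)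
  choose f hf using hg
  let e : n ≃ Fin (Module.finrank K (Submodule.span K (Set.range A.row))) :=
    (Fintype.equivFin n).trans (finCongr hrank.symm)
  refine ⟨f ∘ e, ?_⟩
  have hrow : (A.submatrix (f ∘ e) id).row = g ∘ e := by
    funext i
    exact hf (e i)
  have hunit : IsUnit (A.submatrix (f ∘ e) id) := by
    rw [← linearIndependent_rows_iff_isUnit, hrow]
    exact hli.comp e e.injective
  exact ((isUnit_iff_isUnit_det _).1 hunit).ne_zero

/-- A real solution of a square integral system of determinant `±1` with integral right-hand side
is integral. -/
lemma exists_int_eq_of_isUnit_det {n : Type*} [Fintype n] [DecidableEq n]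
    (A : Matrix n n ℤ) (hA : IsUnit A.det) (y : n → ℝ) (c : n → ℤ)
    (hy : A.map (Int.cast : ℤ → ℝ) *ᵥ y = fun i => (c i : ℝ)) :
    ∃ z : n → ℤ, y = fun i => (z i : ℝ) := by
  refine ⟨A⁻¹ *ᵥ c, ?_⟩
  have hinv : A⁻¹.map (Int.cast : ℤ → ℝ) * A.map (Int.cast : ℤ → ℝ) = 1 := by
    have h := congrArg (Int.castRingHom ℝ).mapMatrix (nonsing_inv_mul A hA)
    rw [map_mul, map_one] at h
    exact h
  calc y = A⁻¹.map (Int.cast : ℤ → ℝ) *ᵥ (A.map (Int.cast : ℤ → ℝ) *ᵥ y) := by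
        rw [mulVec_mulVec, hinv, one_mulVec]
    _ = _ := by
        rw [hy]
        funext i
        simp [mulVec, dotProduct]

/-- If some direction leaves all integral rows of `A y` unchanged but not all rows, then `y` can be
moved, without leaving the cell bounded by the floors and ceilings of `A y`, so that a further row
becomes integral. -/
lemma exists_floor_le_le_ceil_of_mulVec_ne_zero {m n : Type*} [Fintype m] [Fintype n]
    (A : Matrix m n ℝ) (y d : n → ℝ)
    (hd : ∀ i, (A *ᵥ y) i ∈ Set.range (Int.cast : ℤ → ℝ) → (A *ᵥ d) i = 0) (hd0 : A *ᵥ d ≠ 0) :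
    ∃ y' : n → ℝ, (∀ i, (⌊(A *ᵥ y) i⌋ : ℝ) ≤ (A *ᵥ y') i ∧ (A *ᵥ y') i ≤ ⌈(A *ᵥ y) i⌉) ∧
      ∃ i, (A *ᵥ y) i ∉ Set.range (Int.cast : ℤ → ℝ) ∧
        (A *ᵥ y') i ∈ Set.range (Int.cast : ℤ → ℝ) := by
  classical
  set a := A *ᵥ y with ha
  set r := A *ᵥ d with hr
  -- The time at which row `i`, moving along `d`, reaches the end of its floor-ceiling interval; the
  -- smallest such time keeps all rows in their intervals.
  let τ : m → ℝ := fun i => if 0 < r i then (⌈a i⌉ - a i) / r i else (⌊a i⌋ - a i) / r i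
  let S : Finset m := Finset.univ.filter fun i => r i ≠ 0
  have hS : S.Nonempty := by
    obtain ⟨i, hi⟩ := Function.ne_iff.1 hd0
    exact ⟨i, by simpa [S] using hi⟩
  obtain ⟨j, hjS, hj⟩ := S.exists_min_image τ hS
  have hτ : ∀ i, r i ≠ 0 → 0 ≤ τ i := by
    intro i hi
    by_cases h : 0 < r i
    · simp only [τ, if_pos h]
      exact div_nonneg (sub_nonneg.2 (Int.le_ceil _)) h.le
    · simp only [τ, if_neg h]
      exact div_nonneg_of_nonpos (sub_nonpos.2 (Int.floor_le _)) (not_lt.1 h)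
  have hrj : r j ≠ 0 := by simpa [S] using hjS
  have hmul : ∀ i, (A *ᵥ (y + τ j • d)) i = a i + τ j * r i := by
    intro i
    simp [mulVec_add, mulVec_smul, ha, hr]
  refine ⟨y + τ j • d, fun i => ?_, j, fun h => hrj (hd j h), ?_⟩
  · rw [hmul]
    have hfl := Int.floor_le (a i)
    have hce := Int.le_ceil (a i)
    have h0 := hτ j hrj
    rcases lt_trichotomy (r i) 0 with h | h | h
    · have hle := hj i (by simp [S, h.ne])
      simp only [τ, if_neg (not_lt.2 h.le)] at hle
      rw [le_div_iff_of_neg h] at hle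
      constructor
      · linarith
      · nlinarith [mul_nonpos_of_nonneg_of_nonpos h0 h.le]
    · rw [h]
      constructor <;> linarith
    · have hle := hj i (by simp [S, h.ne'])
      rw [show τ i = (⌈a i⌉ - a i) / r i from if_pos h, le_div_iff₀ h] at hle
      constructor
      · nlinarith [mul_nonneg h0 h.le]
      · linarith
  · rw [hmul]
    by_cases h : 0 < r j
    · refine ⟨⌈a j⌉, ?_⟩
      simp only [τ, if_pos h]
      field_simp
      ring
    · refine ⟨⌊a j⌋, ?_⟩
      simp only [τ, if_neg h]
      field_simp
      ring

/-- Every cell bounded by the floors and ceilings of `A y` contains a point `A y'` whose integral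
rows determine all the rows of `A`. -/
lemma exists_floor_le_le_ceil_of_integral_rows {m n : Type*} [Fintype m] [Fintype n]
    (A : Matrix m n ℝ) (y : n → ℝ) :
    ∃ y' : n → ℝ, (∀ i, (⌊(A *ᵥ y) i⌋ : ℝ) ≤ (A *ᵥ y') i ∧ (A *ᵥ y') i ≤ ⌈(A *ᵥ y) i⌉) ∧
      ∀ d, (∀ i, (A *ᵥ y') i ∈ Set.range (Int.cast : ℤ → ℝ) → (A *ᵥ d) i = 0) → A *ᵥ d = 0 := by
  classical
  -- Induction on the number of non-integral rows.
  induction hN : (Finset.univ.filter fun i => (A *ᵥ y) i ∉ Set.range (Int.cast : ℤ → ℝ)).card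
    using Nat.strong_induction_on generalizing y with
  | _ N ih =>
    by_cases h : ∀ d, (∀ i, (A *ᵥ y) i ∈ Set.range (Int.cast : ℤ → ℝ) → (A *ᵥ d) i = 0) →
        A *ᵥ d = 0
    · exact ⟨y, fun i => ⟨Int.floor_le _, Int.le_ceil _⟩, h⟩
    push Not at h
    obtain ⟨d, hd, hd0⟩ := h
    obtain ⟨y₁, hy₁, j, hj, hj₁⟩ := exists_floor_le_le_ceil_of_mulVec_ne_zero A y d hd hd0
    have hkeep : ∀ i, (A *ᵥ y) i ∈ Set.range (Int.cast : ℤ → ℝ) →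
        (A *ᵥ y₁) i ∈ Set.range (Int.cast : ℤ → ℝ) := by
      rintro i ⟨c, hc⟩
      have := hy₁ i
      rw [← hc, Int.floor_intCast, Int.ceil_intCast] at this
      exact ⟨c, le_antisymm this.1 this.2⟩
    obtain ⟨y', hy', hdet⟩ := ih _ (by
      rw [← hN]
      apply Finset.card_lt_card
      rw [Finset.ssubset_iff_of_subset]
      · exact ⟨j, by simpa using hj, by simpa using hj₁⟩
      · intro i hi
        rw [Finset.mem_filter] at hi ⊢
        exact ⟨hi.1, fun hc => hi.2 (hkeep i hc)⟩) y₁ rfl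
    refine ⟨y', fun i => ⟨?_, ?_⟩, hdet⟩
    · exact le_trans (Int.cast_le.2 (Int.le_floor.2 (hy₁ i).1)) (hy' i).1
    · exact le_trans (hy' i).2 (Int.cast_le.2 (Int.ceil_le.2 (hy₁ i).2))

/-- Rounding for totally unimodular matrices: every real vector `y` can be rounded to an integral
vector `z` such that each entry of `A z` is one of the two roundings of the entry of `A y`. -/
theorem IsTotallyUnimodular.exists_floor_le_mulVec_le_ceil {m n : Type*} [Fintype m] [Fintype n]
    {A : Matrix m n ℤ} (hA : A.IsTotallyUnimodular) (y : n → ℝ) :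
    ∃ z : n → ℤ, ∀ i, ⌊(A.map (Int.cast : ℤ → ℝ) *ᵥ y) i⌋ ≤ (A *ᵥ z) i ∧
      (A *ᵥ z) i ≤ ⌈(A.map (Int.cast : ℤ → ℝ) *ᵥ y) i⌉ := by
  classical
  -- The identity block makes the kernel trivial, so the integral rows at `y'` contain a nonsingular
  -- square system; total unimodularity makes its determinant `±1`.
  set B : Matrix (m ⊕ n) n ℤ := fromRows A 1 with hB
  have hBtu : B.IsTotallyUnimodular := hA.fromRows_one
  obtain ⟨y', hy', hdet⟩ := exists_floor_le_le_ceil_of_integral_rows (B.map (Int.cast : ℤ → ℝ)) y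
  have hker : ∀ d : n → ℝ, B.map (Int.cast : ℤ → ℝ) *ᵥ d = 0 → d = 0 := by
    intro d hd
    funext j
    have := congrFun hd (Sum.inr j)
    simpa [hB, mulVec, dotProduct, one_apply] using this
  let J := {i // (B.map (Int.cast : ℤ → ℝ) *ᵥ y') i ∈ Set.range (Int.cast : ℤ → ℝ)}
  obtain ⟨f, hf⟩ := exists_det_submatrix_ne_zero
    ((B.map (Int.cast : ℤ → ℝ)).submatrix (Subtype.val : J → m ⊕ n) id) (by
      intro d hd
      exact hker d (hdet d fun i hi => congrFun hd ⟨i, hi⟩))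
  set C : Matrix n n ℤ := B.submatrix (fun i => (f i).1) id with hC
  have hCdet : IsUnit C.det := by
    have hne : C.det ≠ 0 := by
      intro h0
      apply hf
      have h1 : (C.map (Int.castRingHom ℝ)).det = 0 := by
        rw [← RingHom.mapMatrix_apply, ← RingHom.map_det, h0, map_zero]
      exact h1
    obtain ⟨s, hs⟩ := (isTotallyUnimodular_iff_fintype B).1 hBtu n (fun i => (f i).1) id
    rw [← hC] at hs
    rw [← hs] at hne ⊢
    cases s
    · exact absurd rfl hne
    · exact isUnit_one.neg
    · exact isUnit_one
  choose c hc using fun i => (f i).2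
  obtain ⟨z, rfl⟩ := exists_int_eq_of_isUnit_det C hCdet y' c (by
    funext i
    exact (hc i).symm)
  refine ⟨z, fun i => ?_⟩
  have h := hy' (Sum.inl i)
  have h1 : (B.map (Int.cast : ℤ → ℝ) *ᵥ fun i => (z i : ℝ)) (Sum.inl i) = ((A *ᵥ z) i : ℤ) := by
    simp [hB, mulVec, dotProduct]
  have h2 : (B.map (Int.cast : ℤ → ℝ) *ᵥ y) (Sum.inl i) =
      (A.map (Int.cast : ℤ → ℝ) *ᵥ y) i := by
    simp [hB, mulVec, dotProduct]
  rw [h1, h2] at h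
  exact ⟨by exact_mod_cast h.1, by exact_mod_cast h.2⟩

end Matrix

/-! ### Faces of the projection and their integral points -/

namespace TUProjection

lemma convex_polyhedron {k n : ℕ} (T : Matrix (Fin k) (Fin n) ℤ) (b : Fin k → ℤ) :
    Convex ℝ (polyhedron T b) := by
  intro x hx y hy s t hs ht hst i
  have h1 := mul_le_mul_of_nonneg_left (hx i) hs
  have h2 := mul_le_mul_of_nonneg_left (hy i) ht
  have h3 : s * (b i : ℝ) + t * b i = b i := by rw [← add_mul, hst, one_mul]
  simp only [mulVec_add, mulVec_smul, Pi.add_apply, Pi.smul_apply, smul_eq_mul]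
  linarith

lemma convex_axisProjection {n : ℕ} (I : Finset (Fin n)) {P : Set (Fin n → ℝ)}
    (hP : Convex ℝ P) : Convex ℝ (axisProjection I P) :=
  hP.linear_image (LinearMap.funLeft ℝ ℝ (Subtype.val : I → Fin n))

/-- If every constraint that is tight at `p` is tight at `z`, the segment from `z` to `p` can be
prolonged beyond `p` inside the polyhedron. -/
lemma exists_add_smul_sub_mem_polyhedron {k n : ℕ} {T : Matrix (Fin k) (Fin n) ℤ}
    {b : Fin k → ℤ} {p z : Fin n → ℝ} (hp : p ∈ polyhedron T b)
    (hz : ∀ i, (T.map (Int.cast : ℤ → ℝ) *ᵥ p) i = b i →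
      (T.map (Int.cast : ℤ → ℝ) *ᵥ z) i = b i) :
    ∃ ε : ℝ, 0 < ε ∧ p + ε • (p - z) ∈ polyhedron T b := by
  have hev : ∀ᶠ ε : ℝ in nhdsWithin 0 (Set.Ioi 0), ∀ i,
      (T.map (Int.cast : ℤ → ℝ) *ᵥ (p + ε • (p - z))) i ≤ b i := by
    rw [Filter.eventually_all]
    intro i
    simp only [mulVec_add, mulVec_smul, mulVec_sub, Pi.add_apply, Pi.smul_apply, Pi.sub_apply,
      smul_eq_mul]
    rcases (hp i).eq_or_lt with h | h
    · simp [h, hz i h]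
    · apply Filter.Eventually.filter_mono nhdsWithin_le_nhds
      have hcont : Continuous fun ε : ℝ => (T.map (Int.cast : ℤ → ℝ) *ᵥ p) i +
          ε * ((T.map (Int.cast : ℤ → ℝ) *ᵥ p) i - (T.map (Int.cast : ℤ → ℝ) *ᵥ z) i) := by
        fun_prop
      exact (hcont.continuousAt.eventually_lt_const (by simpa using h)).mono fun _ => le_of_lt
  obtain ⟨ε, h, hε⟩ := (hev.and self_mem_nhdsWithin).exists
  exact ⟨ε, hε, h⟩

/-- A face of the projection that contains the image of `p` contains the image of every point `z`
of the polyhedron at which the constraints tight at `p` are tight. -/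
lemma restrict_mem_of_isExtreme {k n : ℕ} {T : Matrix (Fin k) (Fin n) ℤ} {b : Fin k → ℤ}
    {I : Finset (Fin n)} {F : Set (I → ℝ)}
    (hF : IsExtreme ℝ (axisProjection I (polyhedron T b)) F) {p z : Fin n → ℝ}
    (hp : p ∈ polyhedron T b) (hpF : (fun i : I => p i) ∈ F) (hzP : z ∈ polyhedron T b)
    (hz : ∀ i, (T.map (Int.cast : ℤ → ℝ) *ᵥ p) i = b i →
      (T.map (Int.cast : ℤ → ℝ) *ᵥ z) i = b i) :
    (fun i : I => z i) ∈ F := by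
  obtain ⟨ε, hε, hq⟩ := exists_add_smul_sub_mem_polyhedron hp hz
  -- With `q = p + ε (p - z)`, one has `p = (ε z + q) / (1 + ε)`.
  refine hF.left_mem_of_mem_openSegment ⟨z, hzP, rfl⟩ ⟨_, hq, rfl⟩ hpF
    ⟨ε / (1 + ε), 1 / (1 + ε), by positivity, by positivity, by field_simp; ring, ?_⟩
  funext i
  simp only [Pi.add_apply, Pi.smul_apply, Pi.sub_apply, smul_eq_mul]
  field_simp
  ring

/-- A difference of two points of a one-dimensional set is a multiple of any other nonzero one. -/
lemma exists_smul_eq_sub_of_finrank_eq_one {ι : Type*} {F : Set (ι → ℝ)}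
    (hF : Module.finrank ℝ (vectorSpan ℝ F) = 1) {x₁ x₂ z : ι → ℝ} (hx₁ : x₁ ∈ F) (hx₂ : x₂ ∈ F)
    (hz : z ∈ F) (hne : x₁ - x₂ ≠ 0) : ∃ s : ℝ, s • (x₁ - x₂) = z - x₂ := by
  obtain ⟨s, hs⟩ := exists_smul_eq_of_finrank_eq_one hF
    (x := ⟨x₁ - x₂, vsub_mem_vectorSpan ℝ hx₁ hx₂⟩) (by simpa [Subtype.ext_iff] using hne)
    ⟨z - x₂, vsub_mem_vectorSpan ℝ hz hx₂⟩
  exact ⟨s, congrArg Subtype.val hs⟩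

/-- If the edge direction `v` has nonzero `w`-value, then an edge containing `x` and
`x + v` contains an integral point whose `w`-value differs by exactly one from that of `x`. -/
lemma exists_integral_mem_edge {k n : ℕ} {T : Matrix (Fin k) (Fin n) ℤ} {b : Fin k → ℤ}
    {I : Finset (Fin n)} {F : Set (I → ℝ)}
    (hF : IsExposed ℝ (axisProjection I (polyhedron T b)) F) {w : Fin n → ℤ}
    (hw : TUAppendable T w) (hwI : ∀ i, i ∉ I → w i = 0) {x v : I → ℤ}
    (hx : (fun i => (x i : ℝ)) ∈ F) (hxv : (fun i => ((x + v) i : ℝ)) ∈ F)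
    (hc : (fun i : I => w i) ⬝ᵥ v ≠ 0) :
    ∃ z : I → ℤ, (fun i => (z i : ℝ)) ∈ F ∧
      (fun i : I => w i) ⬝ᵥ (z - x) = ((fun i : I => w i) ⬝ᵥ v).sign := by
  set c := (fun i : I => w i) ⬝ᵥ v with hcdef
  have hc1 : (1 : ℝ) ≤ |(c : ℝ)| := by exact_mod_cast Int.one_le_abs hc
  have hcpos : (0 : ℝ) < |(c : ℝ)| := by linarith
  have hsupp : ∀ (R : Type) [CommRing R] (u : Fin n → R),
      (fun i => (w i : R)) ⬝ᵥ u = (fun i : I => (w i : R)) ⬝ᵥ (fun i : I => u i) := by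
    intro R _ u
    simp only [dotProduct]
    rw [Finset.sum_coe_sort I (fun i => (w i : R) * u i)]
    refine (Finset.sum_subset (Finset.subset_univ I) fun i _ hi => ?_).symm
    simp [hwI i hi]
  have hmem : (fun i => (x i : ℝ) + |(c : ℝ)|⁻¹ * v i) ∈ F := by
    have := hF.convex (convex_axisProjection I (convex_polyhedron T b)) hx hxv
      (sub_nonneg.2 (inv_le_one_of_one_le₀ hc1)) (inv_nonneg.2 hcpos.le) (by ring)
    convert this using 1
    funext i
    simp only [Pi.add_apply, Pi.smul_apply, smul_eq_mul, Int.cast_add]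
    ring
  obtain ⟨p, hp, hpx⟩ := hF.subset hmem
  change (fun i : I => p i) = _ at hpx
  have hwp : (fun i => (w i : ℝ)) ⬝ᵥ p =
      (((fun i : I => w i) ⬝ᵥ x + c.sign : ℤ) : ℝ) := by
    rw [hsupp ℝ p, hpx]
    have hsign : |(c : ℝ)|⁻¹ * c = (c.sign : ℝ) := by
      have h : (c.sign : ℝ) * |(c : ℝ)| = c := by exact_mod_cast Int.sign_mul_abs c
      rw [inv_mul_eq_div, div_eq_iff hcpos.ne', h]
    rw [Int.cast_add, ← hsign, hcdef]
    simp only [dotProduct, Int.cast_sum, Int.cast_mul, Finset.mul_sum]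
    rw [← Finset.sum_add_distrib]
    exact Finset.sum_congr rfl fun i _ => by ring
  obtain ⟨z, hz⟩ := Matrix.IsTotallyUnimodular.exists_floor_le_mulVec_le_ceil hw p
  have hcast : ∀ i, (T.map (Int.cast : ℤ → ℝ) *ᵥ fun j => (z j : ℝ)) i = ((T *ᵥ z) i : ℤ) := by
    intro i
    simp [mulVec, dotProduct]
  have hzT : ∀ i, ⌊(T.map (Int.cast : ℤ → ℝ) *ᵥ p) i⌋ ≤ (T *ᵥ z) i ∧
      (T *ᵥ z) i ≤ ⌈(T.map (Int.cast : ℤ → ℝ) *ᵥ p) i⌉ := fun i => hz (Sum.inl i)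
  have hzw : w ⬝ᵥ z = (fun i : I => w i) ⬝ᵥ x + c.sign := by
    have h : ⌊(fun i => (w i : ℝ)) ⬝ᵥ p⌋ ≤ w ⬝ᵥ z ∧ w ⬝ᵥ z ≤ ⌈(fun i => (w i : ℝ)) ⬝ᵥ p⌉ :=
      hz (Sum.inr ())
    rw [hwp, Int.floor_intCast, Int.ceil_intCast] at h
    exact le_antisymm h.2 h.1
  refine ⟨fun i => z i, restrict_mem_of_isExtreme (z := fun j => (z j : ℝ)) hF.isExtreme hp
    (hpx ▸ hmem) (fun i => ?_) (fun i hi => ?_), ?_⟩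
  · rw [hcast]
    exact_mod_cast (hzT i).2.trans (Int.ceil_le.2 (hp i))
  -- A tight row has the integral value `b i`, which rounding cannot change.
  · have := hzT i
    rw [hi, Int.floor_intCast, Int.ceil_intCast] at this
    rw [hcast, le_antisymm this.2 this.1]
  · have h := hsupp ℤ z
    simp only [Int.cast_id] at h
    rw [dotProduct_sub, ← h]
    change w ⬝ᵥ z - _ = _
    rw [hzw]
    ring

end TUProjection

theorem theorem7 {k n : ℕ} (T : Matrix (Fin k) (Fin n) ℤ) (hT : T.IsTotallyUnimodular)
    (b : Fin k → ℤ) (I : Finset (Fin n)) (v : I → ℤ)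
    (hv : TUProjection.IsEdgeDirection
      (TUProjection.axisProjection I (TUProjection.polyhedron T b)) v)
    (w : Fin n → ℤ) (hw : TUProjection.TUAppendable T w) (hwI : ∀ i, i ∉ I → w i = 0) :
    (fun i : I => w i) ⬝ᵥ v ∈ ({-1, 0, 1} : Set ℤ) := by
  obtain ⟨hgcd, F, ⟨hF, hdim⟩, x₁, x, hx₁, hx, rfl⟩ := hv
  set c := (fun i : I => w i) ⬝ᵥ v with hcdef
  by_cases hc : c = 0
  · simp [hc]
  obtain ⟨z, hzF, hz⟩ := TUProjection.exists_integral_mem_edge hF hw hwI hx hx₁ hc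
  have hv0 : (fun i => ((x + v) i : ℝ)) - (fun i => (x i : ℝ)) = fun i => (v i : ℝ) := by
    funext i
    simp
  obtain ⟨s, hs⟩ := TUProjection.exists_smul_eq_sub_of_finrank_eq_one hdim hx₁ hx hzF (by
    rw [hv0]
    intro h
    apply hc
    have : v = 0 := funext fun i => by simpa using congrFun h i
    rw [hcdef, this, dotProduct_zero])
  rw [hv0] at hs
  have hsi : ∀ i, s * v i = ((z - x) i : ℤ) := fun i => by simpa using congrFun hs i
  -- Pairing `s v = z - x` with `w` gives `s = 1 / |c|`.
  have hsc : s * c = (c.sign : ℝ) := by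
    rw [← hz, hcdef]
    simp only [dotProduct, Int.cast_sum, Int.cast_mul, Finset.mul_sum]
    refine Finset.sum_congr rfl fun i _ => ?_
    rw [← hsi i]
    ring
  have hsgn : (c.sign : ℝ) ≠ 0 := by exact_mod_cast mt Int.sign_eq_zero_iff_zero.1 hc
  have hdvd : c ∣ Finset.univ.gcd v := by
    refine Finset.dvd_gcd fun i _ => ?_
    have h : c ∣ c.sign * v i := by
      refine ⟨(z - x) i, ?_⟩
      have : (c.sign : ℝ) * v i = c * ((z - x) i : ℤ) := by
        rw [← hsc, ← hsi i]
        ring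
      exact_mod_cast this
    rcases lt_or_gt_of_ne hc with h0 | h0
    · rw [Int.sign_eq_neg_one_of_neg h0] at h
      simpa using h
    · rw [Int.sign_eq_one_of_pos h0] at h
      simpa using h
  rw [hgcd] at hdvd
  rcases Int.isUnit_iff.1 (isUnit_of_dvd_one hdvd) with h | h <;> simp [h]
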